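/- Every simplex is Ramsey. That is, let $X\subset\mathbb{R}^n$ be a finite affinely independent set. Then for every positive integer $r$ there exists a positive integer $N$ (depending on $X$ and $r$) such that for every colouring of $\mathbb{R}^N$ with $r$ colours there exists a monochromatic set $X'\subset\mathbb{R}^N$ that is an isometric copy of $X$, where $\mathbb{R}^n$ and $\mathbb{R}^N$ carry the Euclidean distance. -/

import Mathlib

/-- `Y` is an isometric copy of `X`: there is a distance preserving bijection from `X` onto `Y`,
for the Euclidean distances of the two ambient spaces. -/
def IsIsometricCopy {n m : ℕ} (X : Set (EuclideanSpace ℝ (Fin n)))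
    (Y : Set (EuclideanSpace ℝ (Fin m))) : Prop :=
  Nonempty (X ≃ᵢ Y)

/-- `Y` is monochromatic for the colouring `c`: all its points have one and the same colour. -/
def IsMonochromatic {N r : ℕ} (c : EuclideanSpace ℝ (Fin N) → Fin r)
    (Y : Set (EuclideanSpace ℝ (Fin N))) : Prop :=
  ∃ i : Fin r, ∀ y ∈ Y, c y = i

/-- A finite set `X` in `ℝⁿ` is Ramsey if for every positive integer `r` there is a positive
integer `N` such that every `r`-colouring of `ℝᴺ` has a monochromatic isometric copy of `X`. -/
def IsRamsey {n : ℕ} (X : Set (EuclideanSpace ℝ (Fin n))) : Prop :=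
  X.Finite ∧ ∀ r : ℕ, 0 < r → ∃ N : ℕ, 0 < N ∧ ∀ c : EuclideanSpace ℝ (Fin N) → Fin r,
    ∃ Y : Set (EuclideanSpace ℝ (Fin N)), IsIsometricCopy X Y ∧ IsMonochromatic c Y

/-! Place a fixed vector `a` along increasing index sets. Ramsey's theorem makes all placements
inside some large index set one colour, so every distance pattern in `spreadSqDist` occurs
monochromatically. These patterns form a convex cone whose closure contains all Euclidean squared
distances: shifted tents approximate points on a line, and sums supply the remaining dimensions.
Affine independence removes the approximation error. The simplex stays Euclidean after `2 * c` is
taken off every squared distance `D`; if `d` in the cone is close to this reduced pattern, then `D -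
d` is nearly constant off the diagonal, and partition metrics realize it exactly. -/

/-! ### Ramsey's theorem for finite sets -/

/-- End-homogeneity: given Ramsey's theorem for `k`-sets, every large set of naturals contains
a set of `L` elements on whose `(k + 1)`-subsets the colour depends only on the minimum. -/
theorem exists_endHomogeneous {C : Type*} (k : ℕ)
    (ih : ∀ M : ℕ, ∃ N : ℕ, ∀ (c : Finset ℕ → C) (A : Finset ℕ), N ≤ A.card →
      ∃ B ⊆ A, B.card = M ∧ ∃ i, ∀ J ⊆ B, J.card = k → c J = i) (L : ℕ) :
    ∃ N : ℕ, ∀ (c : Finset ℕ → C) (A : Finset ℕ), N ≤ A.card →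
      ∃ B ⊆ A, B.card = L ∧ ∃ f : ℕ → C, ∀ x ∈ B, ∀ J ⊆ B, (∀ y ∈ J, x < y) →
        J.card = k → c (insert x J) = f x := by
  induction L with
  | zero =>
    -- `c ∅` only supplies some element of `C`.
    refine ⟨0, fun c A _ => ⟨∅, by simp, rfl, fun _ => c ∅, by simp⟩⟩
  | succ L hL =>
    obtain ⟨N₁, hN₁⟩ := hL
    obtain ⟨N₂, hN₂⟩ := ih N₁
    refine ⟨N₂ + 1, fun c A hA => ?_⟩
    have hne : A.Nonempty := Finset.card_pos.1 (by omega)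
    set x := A.min' hne with hx
    have hxA : x ∈ A := A.min'_mem hne
    -- Pass to a set homogeneous for the link of the minimum `x`, then recurse inside it.
    obtain ⟨B, hBA, hB, i, hi⟩ := hN₂ (fun J => c (insert x J)) (A.erase x)
      (by rw [Finset.card_erase_of_mem hxA]; omega)
    obtain ⟨B', hB'B, hB', f, hf⟩ := hN₁ c B hB.ge
    have hlt : ∀ y ∈ B', x < y := fun y hy =>
      A.min'_lt_of_mem_erase_min' hne (hBA (hB'B hy))
    have hxB' : x ∉ B' := fun h => lt_irrefl _ (hlt x h)
    refine ⟨insert x B', ?_, by rw [Finset.card_insert_of_notMem hxB', hB'],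
      Function.update f x i, ?_⟩
    · exact Finset.insert_subset hxA
        ((hB'B.trans hBA).trans (Finset.erase_subset _ _))
    · intro y hy J hJ hJy hJk
      have hJB' : J ⊆ B' := by
        intro z hz
        rcases Finset.mem_insert.1 (hJ hz) with rfl | h
        · rcases Finset.mem_insert.1 hy with h' | h'
          · exact absurd (hJy _ hz) (by rw [h']; exact lt_irrefl _)
          · exact absurd (hJy _ hz) (not_lt.2 (hlt y h').le)
        · exact h
      rcases Finset.mem_insert.1 hy with rfl | h
      · rw [Function.update_self]
        exact hi J (hJB'.trans hB'B) hJk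
      · rw [Function.update_of_ne (hlt y h).ne']
        exact hf y h J hJB' hJy hJk

/-- Ramsey's theorem for `k`-element sets of natural numbers, with finitely many colours. -/
theorem exists_monochromatic_subset {C : Type*} [Finite C] (k M : ℕ) :
    ∃ N : ℕ, ∀ (c : Finset ℕ → C) (A : Finset ℕ), N ≤ A.card →
      ∃ B ⊆ A, B.card = M ∧ ∃ i, ∀ J ⊆ B, J.card = k → c J = i := by
  classical
  have := Fintype.ofFinite C
  induction k generalizing M with
  | zero =>
    refine ⟨M, fun c A hA => ?_⟩
    obtain ⟨B, hBA, hB⟩ := Finset.exists_subset_card_eq hA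
    exact ⟨B, hBA, hB, c ∅, fun J _ hJ => by rw [Finset.card_eq_zero.1 hJ]⟩
  | succ k ih =>
    -- The size lets the pigeonhole principle find `M` points sharing one value of `f`.
    obtain ⟨N, hN⟩ := exists_endHomogeneous k ih (Fintype.card C * M + 1)
    refine ⟨N, fun c A hA => ?_⟩
    obtain ⟨B, hBA, hB, f, hf⟩ := hN c A hA
    obtain ⟨i, -, hi⟩ := Finset.exists_lt_card_fiber_of_mul_lt_card_of_maps_to
      (s := B) (t := Finset.univ) (f := f) (n := M) (fun _ _ => Finset.mem_univ _)
      (by rw [hB, Finset.card_univ]; omega)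
    obtain ⟨B', hB', hB'M⟩ := Finset.exists_subset_card_eq hi.le
    refine ⟨B', (hB'.trans (Finset.filter_subset _ _)).trans hBA, hB'M, i, fun J hJ hJk => ?_⟩
    have hne : J.Nonempty := Finset.card_pos.1 (by omega)
    have hx := J.min'_mem hne
    have hJB : J ⊆ B := hJ.trans (hB'.trans (Finset.filter_subset _ _))
    have := hf _ (hJB hx) (J.erase (J.min' hne)) ((Finset.erase_subset _ _).trans hJB)
      (fun y hy => J.min'_lt_of_mem_erase_min' hne hy)
      (by rw [Finset.card_erase_of_mem hx]; omega)
    rw [Finset.insert_erase hx] at this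
    rw [this]
    exact (Finset.mem_filter.1 (hB' (hJ hx))).2

/-! ### Slack in the distances of a simplex -/

open Finset in
/-- The squared distances between the points of a nondegenerate simplex may be decreased by a
common small amount and still be realized in a Euclidean space. -/
theorem exists_sub_const_eq_sum_sq {m n : ℕ} (p : Fin m → EuclideanSpace ℝ (Fin n))
    (hp : AffineIndependent ℝ p) :
    ∃ c : ℝ, 0 < c ∧ ∃ (k : ℕ) (x : Fin k → Fin m → ℝ), ∀ i j, i ≠ j →
      ‖p i - p j‖ ^ 2 - 2 * c = ∑ l, (x l i - x l j) ^ 2 := by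
  let F : EuclideanSpace ℝ (Fin m) →ₗ[ℝ] EuclideanSpace ℝ (Fin n) × ℝ :=
    { toFun := fun z => (∑ i, z i • p i, ∑ i, z i)
      map_add' := fun z w => by simp [add_smul, sum_add_distrib]
      map_smul' := fun r z => by simp [mul_smul, smul_sum, mul_sum] }
  have hF : LinearMap.ker F = ⊥ := by
    rw [LinearMap.ker_eq_bot']
    intro z hz
    have h1 : ∑ i, z i • p i = 0 := congrArg Prod.fst hz
    have h2 : ∑ i, z i = 0 := congrArg Prod.snd hz
    ext i
    exact affineIndependent_iff.1 hp univ (fun i => z i) h2 h1 i (mem_univ i)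
  obtain ⟨K, hK0, hK⟩ := F.exists_antilipschitzWith hF
  have hK0' : (0 : ℝ) < K := hK0
  have key : ∀ z : EuclideanSpace ℝ (Fin m),
      ((K : ℝ) ^ 2)⁻¹ * ∑ i, z i ^ 2 ≤ ‖∑ i, z i • p i‖ ^ 2 + (∑ i, z i) ^ 2 := by
    intro z
    have h := hK.le_mul_dist z 0
    rw [map_zero, dist_zero_right, dist_zero_right] at h
    have h1 : ‖F z‖ ^ 2 ≤ ‖∑ i, z i • p i‖ ^ 2 + (∑ i, z i) ^ 2 := by
      have : ‖F z‖ = max ‖∑ i, z i • p i‖ ‖∑ i, z i‖ := rfl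
      rw [this]
      rcases max_cases ‖∑ i, z i • p i‖ ‖∑ i, z i‖ with h | h <;> rw [h.1]
      · nlinarith [sq_nonneg (∑ i, z i)]
      · rw [Real.norm_eq_abs, sq_abs]; nlinarith [sq_nonneg ‖∑ i, z i • p i‖]
    have h2 : ∑ i, z i ^ 2 = ‖z‖ ^ 2 := by rw [EuclideanSpace.real_norm_sq_eq]
    rw [h2, inv_mul_le_iff₀ (by positivity)]
    calc ‖z‖ ^ 2 ≤ (K * ‖F z‖) ^ 2 := by gcongr
      _ = (K : ℝ) ^ 2 * ‖F z‖ ^ 2 := by ring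
      _ ≤ _ := by gcongr
  refine ⟨((K : ℝ) ^ 2)⁻¹, by positivity, ?_⟩
  set c := ((K : ℝ) ^ 2)⁻¹
  -- Gram matrix plus all-ones matrix minus `c` times the identity: `key` makes it positive
  -- semidefinite, and the all-ones part cancels in distances.
  let M : Matrix (Fin m) (Fin m) ℝ :=
    Matrix.of fun i j => inner ℝ (p i) (p j) + 1 - if i = j then c else 0
  have hM : M.PosSemidef := by
    refine Matrix.PosSemidef.of_dotProduct_mulVec_nonneg ?_ ?_
    · ext i j
      simp [M, real_inner_comm, eq_comm]
    · intro z
      have h := key (WithLp.toLp 2 z)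
      have e : star z ⬝ᵥ M.mulVec z
          = ‖∑ i, z i • p i‖ ^ 2 + (∑ i, z i) ^ 2 - c * ∑ i, z i ^ 2 := by
        rw [← real_inner_self_eq_norm_sq, sq (∑ i, z i), sum_inner, sum_mul_sum, mul_sum]
        simp only [dotProduct, Matrix.mulVec, M, Matrix.of_apply, star_trivial, inner_sum,
          real_inner_smul_left, real_inner_smul_right]
        rw [← sum_add_distrib, ← sum_sub_distrib]
        refine sum_congr rfl fun i _ => ?_
        rw [← sum_add_distrib, mul_sum]
        have : c * z i ^ 2 = ∑ j, if i = j then c * (z i * z j) else 0 := by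
          simp [sq]
        rw [this, ← sum_sub_distrib]
        refine sum_congr rfl fun j _ => ?_
        split_ifs <;> ring
      rw [e]
      simpa using h
  obtain ⟨k, x, hx⟩ := Matrix.posSemidef_iff_eq_sum_vecMulVec.1 hM
  refine ⟨k, x, fun i j hij => ?_⟩
  have hx' : ∀ i j, ∑ l, x l i * x l j = M i j := fun i j => by
    rw [hx]; simp [Matrix.sum_apply, Matrix.vecMulVec_apply]
  have : ∑ l, (x l i - x l j) ^ 2 = M i i + M j j - 2 * M i j := by
    rw [← hx', ← hx', ← hx', ← sum_add_distrib, mul_sum, ← sum_sub_distrib]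
    exact sum_congr rfl fun l _ => by ring
  rw [this, norm_sub_sq_real]
  simp only [M, Matrix.of_apply, if_neg hij, if_true, real_inner_self_eq_norm_sq]
  ring

/-! ### The cone of spread distances -/

/-- The vector with entries `a s` at the positions `f s` and zero elsewhere. -/
def spread {S T : Type} [DecidableEq T] [Fintype S] (a : S → ℝ) (f : S → T) (t : T) : ℝ :=
  ∑ s, if f s = t then a s else 0

/-- The functions that arise as squared distances between order preserving spreads of one
vector. -/
def spreadSqDist (ι : Type) : Set (ι → ι → ℝ) :=
  {d | ∃ (S T : Type) (_ : LinearOrder S) (_ : Fintype S) (_ : LinearOrder T) (_ : Fintype T)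
    (a : S → ℝ) (f : ι → S → T), (∀ i, StrictMono (f i)) ∧
      ∀ i j, d i j = ∑ t, (spread a (f i) t - spread a (f j) t) ^ 2}

namespace spreadSqDist

variable {ι : Type}

/-- Concatenate the two vectors: in lexicographic sums the blocks stay ordered and do not interact.
-/
theorem add_mem {d e : ι → ι → ℝ} (hd : d ∈ spreadSqDist ι) (he : e ∈ spreadSqDist ι) :
    d + e ∈ spreadSqDist ι := by
  obtain ⟨S, T, _, _, _, _, a, f, hf, hd⟩ := hd
  obtain ⟨S', T', _, _, _, _, a', f', hf', he⟩ := he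
  let iS : Fintype (S ⊕ₗ S') := inferInstanceAs (Fintype (S ⊕ S'))
  let iT : Fintype (T ⊕ₗ T') := inferInstanceAs (Fintype (T ⊕ T'))
  have sumT : ∀ g : T ⊕ₗ T' → ℝ, ∑ t, g t = ∑ t, g (toLex (.inl t)) + ∑ t, g (toLex (.inr t)) :=
    fun g => Fintype.sum_sum_type (fun t : T ⊕ T' => g (toLex t))
  have sumS : ∀ g : S ⊕ₗ S' → ℝ, ∑ t, g t = ∑ t, g (toLex (.inl t)) + ∑ t, g (toLex (.inr t)) :=
    fun g => Fintype.sum_sum_type (fun t : S ⊕ S' => g (toLex t))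
  refine ⟨S ⊕ₗ S', T ⊕ₗ T', inferInstance, iS, inferInstance, iT,
    fun s => Sum.elim a a' (ofLex s), fun i s => toLex (Sum.map (f i) (f' i) (ofLex s)), ?_, ?_⟩
  · intro i s s' h
    induction s with | _ s
    induction s' with | _ s'
    rcases s with s | s <;> rcases s' with s' | s' <;> simp at h
    · simpa using hf i h
    · simp
    · simpa using hf' i h
  · intro i j
    rw [Pi.add_apply, Pi.add_apply, hd, he, sumT]
    simp only [spread, sumS]
    simp

theorem smul_mem {d : ι → ι → ℝ} (hd : d ∈ spreadSqDist ι) {w : ℝ} (hw : 0 ≤ w) :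
    w • d ∈ spreadSqDist ι := by
  obtain ⟨S, T, iS, iS', iT, iT', a, f, hf, hd⟩ := hd
  refine ⟨S, T, iS, iS', iT, iT', fun s => √w * a s, f, hf, fun i j => ?_⟩
  have h : ∀ i t, spread (fun s => √w * a s) (f i) t = √w * spread a (f i) t := fun i t => by
    simp [spread, Finset.mul_sum]
  simp only [Pi.smul_apply, smul_eq_mul, hd, h, Finset.mul_sum, ← mul_sub, mul_pow,
    Real.sq_sqrt hw]

theorem zero_mem : (0 : ι → ι → ℝ) ∈ spreadSqDist ι :=
  ⟨Fin 0, Fin 0, inferInstance, inferInstance, inferInstance, inferInstance, 0,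
    fun _ => id, fun _ => strictMono_id, fun i j => by simp⟩

theorem sum_mem {κ : Type*} (s : Finset κ) {d : κ → ι → ι → ℝ}
    (hd : ∀ k ∈ s, d k ∈ spreadSqDist ι) : ∑ k ∈ s, d k ∈ spreadSqDist ι :=
  Finset.sum_induction _ _ (fun _ _ => add_mem) zero_mem hd

/-- Spreads of a single unit entry realize every partition metric. -/
theorem partition_mem {m : ℕ} (u : ι → Fin m) :
    (fun i j => if u i = u j then 0 else 2) ∈ spreadSqDist ι := by
  refine ⟨Unit, Fin m, inferInstance, inferInstance, inferInstance, inferInstance, fun _ => 1,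
    fun i _ => u i, fun i => Subsingleton.strictMono _, ?_⟩
  intro i j
  simp only [spread, Finset.univ_unique, Finset.sum_singleton]
  split_ifs with h
  · simp [h]
  · have : ∀ t, ((if u i = t then (1 : ℝ) else 0) - if u j = t then 1 else 0) ^ 2
        = (if u i = t then 1 else 0) + if u j = t then 1 else 0 := by
      intro t
      split_ifs with h1 h2
      · exact absurd (h1.trans h2.symm) h
      all_goals norm_num
    simp only [this, Finset.sum_add_distrib, Finset.sum_ite_eq, Finset.mem_univ, if_true]
    norm_num

/-! ### Tents and the closure of the cone -/

/-- The tent of height `L` centred at the origin. -/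
def tent (L : ℕ) (t : ℤ) : ℝ := (max (L - |t|) 0 : ℤ)

/-- Translation is order preserving, and the tent vanishes outside `[-L, L]`, so zero padding agrees
with the shifted tent. -/
theorem tent_mem (s : ι → ℕ) (L : ℕ) (B : ℕ) (hB : ∀ i, s i ≤ B) :
    (fun i j => ∑ t ∈ Finset.Icc (-L : ℤ) (L + B), (tent L (t - s i) - tent L (t - s j)) ^ 2)
      ∈ spreadSqDist ι := by
  refine ⟨Finset.Icc (-L : ℤ) L, Finset.Icc (-L : ℤ) (L + B), inferInstance, inferInstance,
    inferInstance, inferInstance, fun t => tent L t, fun i t => ⟨t + s i, ?_⟩, ?_, ?_⟩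
  · have h := Finset.mem_Icc.1 t.2
    have := hB i
    rw [Finset.mem_Icc]
    omega
  · intro i t t' h
    simpa using h
  · intro i j
    beta_reduce
    rw [← Finset.sum_coe_sort (Finset.Icc (-L : ℤ) (L + B))
      (fun t => (tent L (t - s i) - tent L (t - s j)) ^ 2)]
    refine Finset.sum_congr rfl fun t _ => ?_
    congr 2
    all_goals
      simp only [spread, Subtype.ext_iff]
      rw [Finset.sum_coe_sort (Finset.Icc (-L : ℤ) L)
        (fun r => if r + (s _ : ℤ) = (t : ℤ) then tent L r else 0)]
      simp only [← eq_sub_iff_add_eq]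
      rw [Finset.sum_ite_eq']
      split_ifs with h
      · rfl
      · rw [Finset.mem_Icc] at h
        rw [tent, Int.cast_eq_zero, max_eq_right]
        rw [sub_nonpos, le_abs]
        omega

theorem tent_sub_sq_le (L : ℕ) (t u v : ℤ) :
    (tent L (t - u) - tent L (t - v)) ^ 2 ≤ ((u : ℝ) - v) ^ 2 := by
  rw [sq_le_sq, tent, tent]
  norm_cast
  refine (abs_max_sub_max_le_abs _ _ _).trans ?_
  rw [sub_sub_sub_cancel_left]
  refine (abs_abs_sub_abs_le _ _).trans_eq ?_
  congr 1
  ring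

/-- The sum of the squared differences of two shifted tents is between the given bounds. -/
theorem sum_tent_bounds (L B u v : ℕ) (hu : u ≤ B) (hv : v ≤ B) (hL : B ≤ L) :
    (2 * L - 2 * B : ℝ) * ((u : ℝ) - v) ^ 2
      ≤ ∑ t ∈ Finset.Icc (-L : ℤ) (L + B), (tent L (t - u) - tent L (t - v)) ^ 2 ∧
    ∑ t ∈ Finset.Icc (-L : ℤ) (L + B), (tent L (t - u) - tent L (t - v)) ^ 2
      ≤ (2 * L + B + 1 : ℝ) * ((u : ℝ) - v) ^ 2 := by
  constructor
  -- On these two ranges both tents are on the same slope, so they differ by exactly `u - v` up to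
  -- sign.
  · have hsub : Finset.Ioc (B : ℤ) L ∪ Finset.Ico (B - L : ℤ) 0 ⊆ Finset.Icc (-L : ℤ) (L + B) := by
      intro t ht
      rw [Finset.mem_union, Finset.mem_Ioc, Finset.mem_Ico] at ht
      rw [Finset.mem_Icc]
      omega
    have hdisj : Disjoint (Finset.Ioc (B : ℤ) L) (Finset.Ico (B - L : ℤ) 0) := by
      rw [Finset.disjoint_left]
      intro t ht ht'
      rw [Finset.mem_Ioc] at ht
      rw [Finset.mem_Ico] at ht'
      omega
    refine le_trans ?_ (Finset.sum_le_sum_of_subset_of_nonneg hsub fun _ _ _ => sq_nonneg _)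
    have : ∀ t ∈ Finset.Ioc (B : ℤ) L ∪ Finset.Ico (B - L : ℤ) 0,
        (tent L (t - u) - tent L (t - v)) ^ 2 = ((u : ℝ) - v) ^ 2 := by
      intro t ht
      rw [Finset.mem_union, Finset.mem_Ioc, Finset.mem_Ico] at ht
      unfold tent
      rcases ht with ht | ht
      · rw [abs_of_nonneg (by omega), abs_of_nonneg (by omega), max_eq_left (by omega),
          max_eq_left (by omega)]
        push_cast
        ring
      · rw [abs_of_nonpos (by omega), abs_of_nonpos (by omega), max_eq_left (by omega),
          max_eq_left (by omega)]
        push_cast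
        ring
    rw [Finset.sum_congr rfl this, Finset.sum_const, Finset.card_union_of_disjoint hdisj,
      Int.card_Ioc, Int.card_Ico, nsmul_eq_mul]
    refine le_of_eq ?_
    congr 1
    have h1 : ((L : ℤ) - B).toNat = L - B := by omega
    have h2 : ((0 : ℤ) - (B - L)).toNat = L - B := by omega
    rw [h1, h2]
    push_cast [Nat.cast_sub hL]
    ring
  · refine (Finset.sum_le_card_nsmul _ _ (((u : ℝ) - v) ^ 2) fun t _ => ?_).trans_eq ?_
    · exact_mod_cast tent_sub_sq_le L t u v
    · rw [Int.card_Icc, nsmul_eq_mul]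
      have : ((L : ℤ) + B + 1 - -L).toNat = 2 * L + B + 1 := by omega
      rw [this]
      push_cast
      ring

open Filter Topology

theorem closure_smul_mem {d : ι → ι → ℝ} (hd : d ∈ closure (spreadSqDist ι)) {w : ℝ}
    (hw : 0 ≤ w) : w • d ∈ closure (spreadSqDist ι) :=
  map_mem_closure (continuous_const_smul w) hd fun _ h => smul_mem h hw

theorem closure_sum_mem {κ : Type*} (s : Finset κ) {d : κ → ι → ι → ℝ}
    (hd : ∀ k ∈ s, d k ∈ closure (spreadSqDist ι)) :
    ∑ k ∈ s, d k ∈ closure (spreadSqDist ι) :=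
  Finset.sum_induction _ _
    (fun _ _ h h' => map_mem_closure₂ continuous_add h h' fun _ h _ h' => add_mem h h')
    (subset_closure zero_mem) hd

/-- Tents of height `L`, rescaled by `1 / (2 * L)`, have boundary errors of relative order `B / L`.
-/
theorem nat_sq_mem_closure [Fintype ι] (s : ι → ℕ) :
    (fun i j => ((s i : ℝ) - s j) ^ 2) ∈ closure (spreadSqDist ι) := by
  let B := ∑ i, s i
  have hB : ∀ i, s i ≤ B := fun i => Finset.single_le_sum (fun _ _ => Nat.zero_le _)
    (Finset.mem_univ i)
  refine mem_closure_of_tendsto (b := atTop) (f := fun L : ℕ => ((2 * L : ℝ)⁻¹) • fun i j =>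
    ∑ t ∈ Finset.Icc (-L : ℤ) (L + B), (tent L (t - s i) - tent L (t - s j)) ^ 2) ?_
    (Eventually.of_forall fun L => smul_mem (tent_mem s L B hB) (by positivity))
  rw [tendsto_pi_nhds]
  intro i
  rw [tendsto_pi_nhds]
  intro j
  have lim : ∀ C : ℝ, Tendsto (fun L : ℕ => (1 + C * (L : ℝ)⁻¹) * ((s i : ℝ) - s j) ^ 2) atTop
      (𝓝 (((s i : ℝ) - s j) ^ 2)) := by
    intro C
    have := ((tendsto_inv_atTop_nhds_zero_nat (𝕜 := ℝ)).const_mul C).const_add 1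
    simpa using this.mul_const (((s i : ℝ) - s j) ^ 2)
  refine tendsto_of_tendsto_of_tendsto_of_le_of_le' (lim (-B)) (lim ((B + 1) / 2)) ?_ ?_
  all_goals
    filter_upwards [eventually_ge_atTop B, eventually_gt_atTop 0] with L hL hL0
    have hL0' : (0 : ℝ) < L := by exact_mod_cast hL0
    have h := sum_tent_bounds L B (s i) (s j) (hB i) (hB j) hL
    simp only [Pi.smul_apply, smul_eq_mul]
  · rw [le_inv_mul_iff₀ (by positivity)]
    refine le_of_eq_of_le ?_ h.1
    field_simp
    ring
  · rw [inv_mul_le_iff₀ (by positivity)]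
    refine le_of_le_of_eq h.2 ?_
    field_simp
    ring

/-- Translate to nonnegative values, then approximate by fractions with denominator `q`. -/
theorem real_sq_mem_closure [Fintype ι] (x : ι → ℝ) :
    (fun i j => (x i - x j) ^ 2) ∈ closure (spreadSqDist ι) := by
  let C := ∑ i, |x i|
  have hC : ∀ i, 0 ≤ x i + C := fun i => by
    have : |x i| ≤ C := Finset.single_le_sum (f := fun i => |x i|) (fun _ _ => abs_nonneg _)
      (Finset.mem_univ i)
    linarith [neg_abs_le (x i)]
  refine isClosed_closure.mem_of_tendsto (b := atTop) (f := fun q : ℕ => (((q : ℝ) ^ 2)⁻¹) •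
    fun i j => (((⌊(x i + C) * q⌋₊ : ℕ) : ℝ) - (⌊(x j + C) * q⌋₊ : ℕ)) ^ 2) ?_
    (Eventually.of_forall fun q => closure_smul_mem (nat_sq_mem_closure _) (by positivity))
  rw [tendsto_pi_nhds]
  intro i
  rw [tendsto_pi_nhds]
  intro j
  have lim : ∀ i, Tendsto (fun q : ℕ => ((⌊(x i + C) * q⌋₊ : ℕ) : ℝ) / q) atTop (𝓝 (x i + C)) :=
    fun i => (tendsto_nat_floor_mul_div_atTop (hC i)).comp tendsto_natCast_atTop_atTop
  have := ((lim i).sub (lim j)).pow 2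
  rw [add_sub_add_right_eq_sub] at this
  refine this.congr fun q => ?_
  simp only [Pi.smul_apply, smul_eq_mul]
  rw [← sub_div, div_pow, div_eq_inv_mul]

/-! ### Exact realization -/

/-- Almost regular distance functions are realized exactly. -/
theorem almost_regular_mem {m : ℕ} (e : Fin m → Fin m → ℝ) (he : ∀ i j, e i j = e j i)
    (hd : ∀ i, e i i = 0) {c : ℝ} (hc : 0 < c)
    (hce : ∀ i j, i ≠ j → |e i j - 2 * c| ≤ c / (m ^ 2 + 1)) : e ∈ spreadSqDist (Fin m) := by
  set δ := c / ((m : ℝ) ^ 2 + 1) with hδ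
  have hδ0 : 0 < δ := by positivity
  have hδc : δ * (m ^ 2 + 1) = c := by rw [hδ]; field_simp
  set h := 2 * c + δ with hh
  -- `E r` merges the two points of `r`, lowering only their distance. Each pair occurs in both
  -- orders and loses 2 each time, hence the 4.
  let w : Fin m × Fin m → ℝ := fun r => if r.1 = r.2 then 0 else (h - e r.1 r.2) / 4
  let E : Fin m × Fin m → Fin m → Fin m → ℝ := fun r i j =>
    if (if i = r.2 then r.1 else i) = (if j = r.2 then r.1 else j) then 0 else 2
  have hw : ∀ r, 0 ≤ w r ∧ w r ≤ δ / 2 := by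
    intro r
    simp only [w]
    split_ifs with hr
    · constructor <;> linarith
    · have := abs_le.1 (hce _ _ hr)
      constructor <;> linarith
  have hW : ∑ r, w r ≤ m ^ 2 * (δ / 2) := by
    refine (Finset.sum_le_card_nsmul _ _ _ fun r _ => (hw r).2).trans_eq ?_
    simp [sq]
  have hW0 : 0 ≤ h / 2 - ∑ r, w r := by nlinarith
  have key : e = ∑ r, w r • E r
      + (h / 2 - ∑ r, w r) • fun i j : Fin m => if i = j then (0 : ℝ) else 2 := by
    funext i j
    simp only [Pi.add_apply, Finset.sum_apply, Pi.smul_apply, smul_eq_mul]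
    by_cases hij : i = j
    · subst hij
      simp [E, hd]
    · have hterm : ∀ r, w r * E r i j
          = 2 * w r - 2 * (if r = (i, j) then w r else 0) - 2 * (if r = (j, i) then w r else 0) := by
        rintro ⟨a, b⟩
        simp only [w, E, Prod.mk.injEq]
        by_cases hab : a = b
        · simp [hab]
        · grind
      rw [Finset.sum_congr rfl fun r _ => hterm r]
      simp only [Finset.sum_sub_distrib, ← Finset.mul_sum, Finset.sum_ite_eq', Finset.mem_univ,
        if_true, if_neg hij]
      simp only [w, if_neg hij, if_neg (Ne.symm hij)]
      rw [he j i]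
      ring
  rw [key]
  exact add_mem (sum_mem _ fun r _ => smul_mem (partition_mem _) (hw r).1)
    (smul_mem (partition_mem id) hW0)

theorem comm {d : ι → ι → ℝ} (hd : d ∈ spreadSqDist ι) (i j : ι) : d i j = d j i := by
  obtain ⟨S, T, _, _, _, _, a, f, -, hd⟩ := hd
  rw [hd, hd]
  exact Finset.sum_congr rfl fun t _ => by ring

theorem self {d : ι → ι → ℝ} (hd : d ∈ spreadSqDist ι) (i : ι) : d i i = 0 := by
  obtain ⟨S, T, _, _, _, _, a, f, -, hd⟩ := hd
  simp [hd]

/-- A distance function that stays Euclidean after a small uniform decrease is realized by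
spreads. -/
theorem mem_of_sub_const {m k : ℕ} (D : Fin m → Fin m → ℝ) (hD : ∀ i j, D i j = D j i)
    (hD0 : ∀ i, D i i = 0) {c : ℝ} (hc : 0 < c) (x : Fin k → Fin m → ℝ)
    (hx : ∀ i j, i ≠ j → D i j - 2 * c = ∑ l, (x l i - x l j) ^ 2) :
    D ∈ spreadSqDist (Fin m) := by
  have hmem : ∑ l, (fun i j => (x l i - x l j) ^ 2) ∈ closure (spreadSqDist (Fin m)) :=
    closure_sum_mem _ fun l _ => real_sq_mem_closure (x l)
  obtain ⟨d, hd, hdist⟩ := Metric.mem_closure_iff.1 hmem (c / (m ^ 2 + 1)) (by positivity)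
  have : D - d ∈ spreadSqDist (Fin m) := by
    refine almost_regular_mem _ (fun i j => ?_) (fun i => ?_) hc fun i j hij => ?_
    · rw [Pi.sub_apply, Pi.sub_apply, Pi.sub_apply, Pi.sub_apply, hD, comm hd]
    · rw [Pi.sub_apply, Pi.sub_apply, hD0, self hd, sub_zero]
    · have h1 := (dist_le_pi_dist _ _ j).trans ((dist_le_pi_dist _ _ i).trans hdist.le)
      rw [Real.dist_eq, Finset.sum_apply, Finset.sum_apply, ← hx i j hij] at h1
      rwa [Pi.sub_apply, Pi.sub_apply, sub_right_comm]
  rw [← sub_add_cancel D d]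
  exact add_mem this hd

end spreadSqDist

/-! ### From spreads to monochromatic copies -/

/-- Every colouring of a Euclidean space of large dimension has a monochromatic family of points
with given squared distances, if these are realized by spreads. -/
theorem exists_monochromatic_of_mem_spreadSqDist {ι : Type} {d : ι → ι → ℝ}
    (hd : d ∈ spreadSqDist ι) (r : ℕ) :
    ∃ N : ℕ, 0 < N ∧ ∀ c : EuclideanSpace ℝ (Fin N) → Fin r,
      ∃ v : ι → EuclideanSpace ℝ (Fin N), (∀ i j, ‖v i - v j‖ ^ 2 = d i j) ∧
        ∃ i₀, ∀ i, c (v i) = i₀ := by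
  obtain ⟨S, T, _, _, _, _, a, f, hf, hd⟩ := hd
  obtain ⟨N, hN⟩ := exists_monochromatic_subset (C := Fin r) (Fintype.card S) (Fintype.card T)
  refine ⟨N + 1, N.succ_pos, fun c => ?_⟩
  let eS := Fintype.orderIsoFinOfCardEq S rfl
  let eT := Fintype.orderIsoFinOfCardEq T rfl
  let V : (S → ℕ) → EuclideanSpace ℝ (Fin (N + 1)) := fun g =>
    WithLp.toLp 2 fun n => spread a g n
  -- A set `J` gets the colour of `a` placed along it; `c 0` is never used for sets of the relevant
  -- size.
  obtain ⟨B, hBA, hB, i₀, hi₀⟩ := hN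
    (fun J => if h : J.card = Fintype.card S then c (V fun s => J.orderEmbOfFin h (eS.symm s))
      else c 0) (Finset.range (N + 1)) (by simp)
  let ψ : T → ℕ := fun t => B.orderEmbOfFin hB (eT.symm t)
  have hψ : StrictMono ψ := (B.orderEmbOfFin hB).strictMono.comp eT.symm.strictMono
  have hψB : ∀ t, ψ t ∈ B := fun t => B.orderEmbOfFin_mem hB _
  refine ⟨fun i => V (ψ ∘ f i), fun i j => ?_, i₀, fun i => ?_⟩
  · rw [EuclideanSpace.real_norm_sq_eq, hd]
    have hs : ∀ i t, spread a (ψ ∘ f i) (ψ t) = spread a (f i) t := fun i t => by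
      simp [spread, hψ.injective.eq_iff]
    simp only [V, PiLp.sub_apply]
    rw [Fin.sum_univ_eq_sum_range
      (fun n => (spread a (ψ ∘ f i) n - spread a (ψ ∘ f j) n) ^ 2) (N + 1)]
    have hsub : Finset.univ.image ψ ⊆ Finset.range (N + 1) := by
      intro n hn
      obtain ⟨t, -, rfl⟩ := Finset.mem_image.1 hn
      exact hBA (hψB t)
    rw [← Finset.sum_subset hsub, Finset.sum_image hψ.injective.injOn]
    · simp only [hs]
    · intro n _ hn
      have h0 : ∀ i, spread a (ψ ∘ f i) n = 0 := fun i => by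
        refine Finset.sum_eq_zero fun s _ => if_neg fun h => hn ?_
        rw [← h]
        exact Finset.mem_image_of_mem _ (Finset.mem_univ _)
      simp [h0]
  · have hg : StrictMono (ψ ∘ f i) := hψ.comp (hf i)
    set J := Finset.univ.image (ψ ∘ f i) with hJ
    have hcard : J.card = Fintype.card S := by
      rw [hJ, Finset.card_image_of_injective _ hg.injective, Finset.card_univ]
    have hJB : J ⊆ B := by
      intro n hn
      obtain ⟨s, -, rfl⟩ := Finset.mem_image.1 hn
      exact hψB _
    have h := hi₀ J hJB hcard
    rw [dif_pos hcard] at h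
    have hfun : (fun s => J.orderEmbOfFin hcard (eS.symm s)) = ψ ∘ f i := by
      have := J.orderEmbOfFin_unique hcard (f := fun k => (ψ ∘ f i) (eS k))
        (fun k => Finset.mem_image_of_mem _ (Finset.mem_univ _)) (hg.comp eS.strictMono)
      funext s
      rw [← this]
      simp
    rw [hfun] at h
    exact h

theorem mainTheorem2 (n : ℕ) (X : Set (EuclideanSpace ℝ (Fin n))) (hfin : X.Finite)
    (hX : AffineIndependent ℝ ((↑) : X → EuclideanSpace ℝ (Fin n))) :
    IsRamsey X := by
  refine ⟨hfin, fun r _ => ?_⟩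
  have := hfin.fintype
  let e := Fintype.equivFin X
  let p : Fin (Fintype.card X) → EuclideanSpace ℝ (Fin n) := fun i => e.symm i
  have hp : AffineIndependent ℝ p := hX.comp_embedding e.symm.toEmbedding
  obtain ⟨δ, hδ, k, x, hx⟩ := exists_sub_const_eq_sum_sq p hp
  have hmem : (fun i j => ‖p i - p j‖ ^ 2) ∈ spreadSqDist (Fin (Fintype.card X)) :=
    spreadSqDist.mem_of_sub_const _ (fun i j => by rw [norm_sub_rev]) (fun i => by simp) hδ x hx
  obtain ⟨N, hN, h⟩ := exists_monochromatic_of_mem_spreadSqDist hmem r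
  refine ⟨N, hN, fun c => ?_⟩
  obtain ⟨v, hv, i₀, hc⟩ := h c
  have hiso : Isometry fun y : X => v (e y) := by
    refine Isometry.of_dist_eq fun y z => ?_
    rw [Subtype.dist_eq, dist_eq_norm, dist_eq_norm, ← sq_eq_sq₀ (norm_nonneg _) (norm_nonneg _),
      hv]
    simp [p]
  refine ⟨Set.range fun y : X => v (e y), ⟨hiso.isometryEquivOnRange⟩, i₀, ?_⟩
  rintro _ ⟨y, rfl⟩
  exact hc _
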